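/- Let $\mathbb H$ be Hamilton's algebra of quaternions and let $\mathbb M=\mathbb C\otimes_{\mathbb R}\mathbb H=\mathbb H+i\mathbb H$ be its complexification, in which the complex scalars commute with $\mathbb H$, endowed with its $C^*$-norm, that is, the norm obtained from the operator norm through the standard isomorphism of $\mathbb M$ with the algebra of complex $2\times2$ matrices. For $\mathbf q\in\mathbb H$ let $\sigma(\mathbf q)=\{\lambda\in\mathbb C:\lambda-\mathbf q \text{ is not invertible in }\mathbb M\}$, and for $U\subset\mathbb C$ put $U_{\mathbb H}=\{\mathbf q\in\mathbb H:\sigma(\mathbf q)\subset U\}$. A *Cauchy domain* in an open set $U\subset\mathbb C$ is a bounded open set $\Delta$ with $\overline\Delta\subset U$ whose boundary is a finite union of piecewise smooth closed curves, positively oriented (together they have winding number $1$ about each point of $\Delta$ and $0$ about each point off $\overline\Delta$). For an analytic function $F:U\to\mathbb M$ the *Cauchy transform* $C[F]:U_{\mathbb H}\to\mathbb M$ is given by $$C[F](\mathbf q)=\frac1{2\pi i}\int_\Gamma F(\zeta)(\zeta-\mathbf q)^{-1}\,d\zeta ,$$ where $\Gamma$ is the oriented boundary of a Cauchy domain in $U$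 that contains $\sigma(\mathbf q)$. Let $\mathbb S$ be the set of purely imaginary quaternions of norm $1$. A function $G:\Omega\to\mathbb M$ on an open set $\Omega\subset\mathbb H$ is *(right) slice regular* on $\Omega$ if it is (real) differentiable on $\Omega$ and, for all $\mathfrak s\in\mathbb S$ and all $x,y\in\mathbb R$ with $x+y\mathfrak s\in\Omega$, $$\frac12\left(\frac{\partial}{\partial x}G(x+y\mathfrak s)+\Big(\frac{\partial}{\partial y}G(x+y\mathfrak s)\Big)\mathfrak s\right)=0 .$$ **Proposition.** Let $U\subset\mathbb C$ be open and conjugate symmetric (that is, $\zeta\in U$ if and only if $\bar\zeta\in U$), and let $F:U\to\mathbb M$ be analytic. Then $C[F]$ is well defined on $U_{\mathbb H}$ (for every $\mathbf q\in U_{\mathbb H}$ there is a Cauchy domain in $U$ that contains $\sigma(\mathbf q)$, and the value $C[F](\mathbf q)$ does not depend on which one is used), the set $U_{\mathbb H}$ is open, and $C[F]$ is (right) slice regular on $U_{\mathbb H}$. -/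

import Mathlib

open scoped ComplexConjugate

noncomputable section

/-- The standard representation by complex `2 × 2` matrices of the quaternions with complex
coefficients. -/
def quatToMatrix : Quaternion ℂ →ₐ[ℂ] Matrix (Fin 2) (Fin 2) ℂ :=
  AlgHom.ofLinearMap
    { toFun := fun a =>
        !![a.re + Complex.I * a.imI, a.imJ + Complex.I * a.imK;
          -a.imJ + Complex.I * a.imK, a.re - Complex.I * a.imI]
      map_add' := by
        intro a b
        ext i j
        fin_cases i <;> fin_cases j <;> simp [Quaternion.re_add, Quaternion.imI_add,
          Quaternion.imJ_add, Quaternion.imK_add] <;> ring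
      map_smul' := by
        intro c a
        ext i j
        fin_cases i <;> fin_cases j <;> simp [Quaternion.re_smul, Quaternion.imI_smul,
          Quaternion.imJ_smul, Quaternion.imK_smul] <;> ring }
    (by
      ext i j
      fin_cases i <;> fin_cases j <;> simp [Quaternion.re_one, Quaternion.imI_one,
          Quaternion.imJ_one, Quaternion.imK_one])
    (by
      intro a b
      ext i j
      fin_cases i <;> fin_cases j <;>
        simp [Matrix.mul_apply, Fin.sum_univ_two, Quaternion.re_mul, Quaternion.imI_mul,
          Quaternion.imJ_mul, Quaternion.imK_mul] <;> ring_nf <;>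
        simp only [Complex.I_sq] <;> ring)

theorem quatToMatrix_injective : Function.Injective quatToMatrix := by
  intro a b h
  have h (i j : Fin 2) := congrFun (congrFun h i) j
  have h00 : a.re + Complex.I * a.imI = b.re + Complex.I * b.imI := h 0 0
  have h01 : a.imJ + Complex.I * a.imK = b.imJ + Complex.I * b.imK := h 0 1
  have h10 : -a.imJ + Complex.I * a.imK = -b.imJ + Complex.I * b.imK := h 1 0
  have h11 : a.re - Complex.I * a.imI = b.re - Complex.I * b.imI := h 1 1
  have hI := Complex.I_ne_zero
  apply Quaternion.ext
  · linear_combination (h00 + h11) / 2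
  · exact mul_left_cancel₀ hI (by linear_combination (h00 - h11) / 2)
  · linear_combination (h01 - h10) / 2
  · exact mul_left_cancel₀ hI (by linear_combination (h01 + h10) / 2)

/-- The complexification `𝕄 = ℍ + iℍ` of Hamilton's algebra: quaternions with complex
coefficients, the scalar `i ∈ ℂ` being central and distinct from the quaternionic units.
It is a type of its own, so that its only scalar structures are the `ℂ`-algebra structure below
and the induced `ℝ`-structure. -/
def BiQuat : Type := Quaternion ℂ

namespace BiQuat

instance : Ring BiQuat := inferInstanceAs (Ring (Quaternion ℂ))

instance : Algebra ℂ BiQuat := inferInstanceAs (Algebra ℂ (Quaternion ℂ))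

/-- The matrix representation, on `𝕄`. -/
def toMatrix : BiQuat →ₐ[ℂ] Matrix (Fin 2) (Fin 2) ℂ := quatToMatrix

theorem toMatrix_injective : Function.Injective toMatrix := quatToMatrix_injective

/-- `𝕄` carries the `C*`-norm of the `2 × 2` matrices (the `ℓ²` operator norm). -/
instance : NormedRing BiQuat :=
  letI : NormedRing (Matrix (Fin 2) (Fin 2) ℂ) := Matrix.instL2OpNormedRing
  NormedRing.induced BiQuat (Matrix (Fin 2) (Fin 2) ℂ) toMatrix toMatrix_injective

instance : NormedAlgebra ℂ BiQuat :=
  letI : NormedRing (Matrix (Fin 2) (Fin 2) ℂ) := Matrix.instL2OpNormedRing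
  letI : NormedAlgebra ℂ (Matrix (Fin 2) (Fin 2) ℂ) := Matrix.instL2OpNormedAlgebra
  NormedAlgebra.induced ℂ BiQuat (Matrix (Fin 2) (Fin 2) ℂ) toMatrix

/-- The inclusion `ℍ ⊂ 𝕄`. -/
def ofQuat : Quaternion ℝ →+* BiQuat where
  toFun x := (⟨x.re, x.imI, x.imJ, x.imK⟩ : Quaternion ℂ)
  map_one' := QuaternionAlgebra.ext Complex.ofReal_one Complex.ofReal_zero Complex.ofReal_zero
    Complex.ofReal_zero
  map_zero' := QuaternionAlgebra.ext Complex.ofReal_zero Complex.ofReal_zero Complex.ofReal_zero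
    Complex.ofReal_zero
  map_mul' x y := by
    change _ = (⟨x.re, x.imI, x.imJ, x.imK⟩ : Quaternion ℂ) * ⟨y.re, y.imI, y.imJ, y.imK⟩
    apply Quaternion.ext <;> simp <;> ring
  map_add' x y := by
    change _ = (⟨x.re, x.imI, x.imJ, x.imK⟩ : Quaternion ℂ) + ⟨y.re, y.imI, y.imJ, y.imK⟩
    apply Quaternion.ext <;> simp

end BiQuat

/-- The spectrum of a quaternion, taken in the complex algebra `𝕄`. -/
def quatSpectrum (q : Quaternion ℝ) : Set ℂ := spectrum ℂ (BiQuat.ofQuat q)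

/-- `S_ℍ`, the set of the quaternions whose spectrum lies in `S`. -/
def quatSet (S : Set ℂ) : Set (Quaternion ℝ) := {q | quatSpectrum q ⊆ S}

/-- Conjugate symmetric subsets of `ℂ`. -/
def IsConjSymm (S : Set ℂ) : Prop := ∀ ζ : ℂ, ζ ∈ S ↔ conj ζ ∈ S

/-- Closed piecewise continuously differentiable curves, parametrized by `[0, 1]`. -/
structure IsPiecewiseSmoothLoop (γ : ℝ → ℂ) : Prop where
  continuousOn : ContinuousOn γ (Set.Icc 0 1)
  closed : γ 0 = γ 1
  piecewise : ∃ (m : ℕ) (t : Fin (m + 1) → ℝ), StrictMono t ∧ t 0 = 0 ∧ t (Fin.last m) = 1 ∧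
    ∀ k : Fin m, ContDiffOn ℝ 1 γ (Set.Icc (t k.castSucc) (t k.succ))

/-- The contour integral `∫_γ f(ζ) dζ`. -/
def contourIntegral {E : Type*} [NormedAddCommGroup E] [NormedSpace ℂ E]
    (f : ℂ → E) (γ : ℝ → ℂ) : E :=
  ∫ t in (0 : ℝ)..1, deriv γ t • f (γ t)

/-- A Cauchy domain in `U`: a bounded open set with closure in `U`, whose boundary consists of
finitely many piecewise smooth closed curves. The boundary is positively oriented in the usual
sense that these curves together wind once around each point of the domain and do not wind
around any point off its closure. -/
structure CauchyDomain (U : Set ℂ) where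
  carrier : Set ℂ
  isOpen : IsOpen carrier
  isBounded : Bornology.IsBounded carrier
  closure_subset : closure carrier ⊆ U
  numCurves : ℕ
  curve : Fin numCurves → ℝ → ℂ
  loop : ∀ i, IsPiecewiseSmoothLoop (curve i)
  frontier_eq : frontier carrier = ⋃ i, curve i '' Set.Icc 0 1
  winding_inside : ∀ z ∈ carrier,
    (2 * Real.pi * Complex.I)⁻¹ * ∑ i, contourIntegral (fun ζ => (ζ - z)⁻¹) (curve i) = 1
  winding_outside : ∀ z ∉ closure carrier,
    (2 * Real.pi * Complex.I)⁻¹ * ∑ i, contourIntegral (fun ζ => (ζ - z)⁻¹) (curve i) = 0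

/-- The integral `∫_Γ f(ζ) dζ` over the oriented boundary `Γ` of a Cauchy domain. -/
def CauchyDomain.boundaryIntegral {U : Set ℂ} (D : CauchyDomain U) {E : Type*}
    [NormedAddCommGroup E] [NormedSpace ℂ E] (f : ℂ → E) : E :=
  ∑ i, contourIntegral f (D.curve i)

/-- `(2πi)⁻¹ ∫_Γ F(ζ) (ζ - q)⁻¹ dζ`, where `Γ` is the boundary of the Cauchy domain `D`. -/
def cauchyIntegral {U : Set ℂ} (D : CauchyDomain U) (F : ℂ → BiQuat) (q : Quaternion ℝ) :
    BiQuat :=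
  (2 * Real.pi * Complex.I)⁻¹ •
    D.boundaryIntegral fun ζ => F ζ * Ring.inverse (algebraMap ℂ BiQuat ζ - BiQuat.ofQuat q)

open Classical in
/-- The Cauchy transform `C[F]`: its value at `q` is the Cauchy integral over the boundary of a
Cauchy domain in `U` that contains the spectrum of `q` (a domain is picked by choice; the value
is `0` where there is none, which does not happen at the points of `U_ℍ`). -/
def cauchyTransform (U : Set ℂ) (F : ℂ → BiQuat) (q : Quaternion ℝ) : BiQuat :=
  if h : ∃ D : CauchyDomain U, quatSpectrum q ⊆ D.carrier then cauchyIntegral h.choose F q else 0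

/-- The sphere `𝕊` of purely imaginary unit quaternions. -/
def imagUnits : Set (Quaternion ℝ) := {s | s.re = 0 ∧ ‖s‖ = 1}

/-- `∂̄_s G (x + y s) = ½ (∂/∂x + R_s ∂/∂y) G (x + y s)`, where `R_s` is the right multiplication
by `s`. -/
def sliceDbar (s : Quaternion ℝ) (G : Quaternion ℝ → BiQuat) (x y : ℝ) : BiQuat :=
  (1 / 2 : ℝ) • (deriv (fun u : ℝ => G ((u : Quaternion ℝ) + y • s)) x +
    deriv (fun v : ℝ => G ((x : Quaternion ℝ) + v • s)) y * BiQuat.ofQuat s)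

/-- Right slice regular `𝕄`-valued functions on an open set of quaternions. -/
structure IsSliceRegularOn (G : Quaternion ℝ → BiQuat) (Ω : Set (Quaternion ℝ)) : Prop where
  isOpen : IsOpen Ω
  differentiableOn : DifferentiableOn ℝ G Ω
  dbar_eq_zero : ∀ s ∈ imagUnits, ∀ x y : ℝ, (x : Quaternion ℝ) + y • s ∈ Ω →
    sliceDbar s G x y = 0

end

/-! ### Contour integrals over piecewise smooth loops. -/

section ContourIntegral

variable {E : Type*} [NormedAddCommGroup E] [NormedSpace ℂ E]

/-! For `s ∈ 𝕊`, the elements `e = (1 - is)/2` and `e' = (1 + is)/2` of `𝕄` are complementary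
orthogonal idempotents with `e s = i e` and `e' s = -i e'`, and `x + y s = (x + iy) e + (x - iy)
e'`. So the spectrum of `x + y s` is `{x ± iy}` and its resolvent is diagonal along `e, e'`.
Cauchy's formula then gives `C[F](x + y s) = F(x + iy) e + F(x - iy) e'`
(`cauchyIntegral_add_smul`), where the contour no longer appears.

Conjugate symmetry makes `U_ℍ` the preimage of `U` under the continuous map `q ↦ Re q + i|Im q|`,
hence open. In the closed formula `∂/∂y` produces factors `±i` and right multiplication by `s`
produces them again, so the two terms of the slice operator cancel. Real differentiability is a
composition off the real axis; at real points it follows from the first-order expansion of `F`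
(`hasFDerivAt_stemValue_of_im_eq_zero`).

Since a Cauchy domain is specified through winding numbers, Cauchy's formula is obtained by Dixon's
argument: the boundary integral of the difference quotient extends to an entire function vanishing
at infinity, which is zero by Liouville (`boundaryIntegral_dslope_eq_zero`). -/

theorem IsPiecewiseSmoothLoop.intervalIntegrable_deriv {γ : ℝ → ℂ}
    (hγ : IsPiecewiseSmoothLoop γ) :
    IntervalIntegrable (deriv γ) MeasureTheory.volume 0 1 := by
  obtain ⟨m, t, ht, h0, h1, hk⟩ := hγ.piecewise
  have key : ∀ k : Fin m,
      IntervalIntegrable (deriv γ) MeasureTheory.volume (t k.castSucc) (t k.succ) := by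
    intro k
    have hlt : t k.castSucc < t k.succ := ht k.castSucc_lt_succ
    have hc := (hk k).continuousOn_derivWithin (uniqueDiffOn_Icc hlt) le_rfl
    rw [← Set.uIcc_of_le hlt.le] at hc
    refine hc.intervalIntegrable.congr_ae ?_
    -- At the break points `deriv` may differ from the one-sided derivative; they form a null set.
    rw [Set.uIoc_of_le hlt.le, ← MeasureTheory.restrict_Ioo_eq_restrict_Ioc]
    filter_upwards [MeasureTheory.ae_restrict_mem measurableSet_Ioo] with x hx
    rw [Set.uIcc_of_le hlt.le]
    exact derivWithin_of_mem_nhds (Icc_mem_nhds hx.1 hx.2)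
  -- The subdivision is extended to `ℕ` by the value `0`, never met for indices up to `m`.
  have step := IntervalIntegrable.trans_iterate (f := deriv γ) (μ := MeasureTheory.volume)
    (a := fun j : ℕ => if h : j < m + 1 then t ⟨j, h⟩ else 0) (n := m) (by
      intro k hk
      simp only [show k < m + 1 by omega, show k + 1 < m + 1 by omega, dite_true]
      exact key ⟨k, hk⟩)
  simp only [show (0 : ℕ) < m + 1 by omega, show m < m + 1 by omega, dite_true] at step
  rw [← h0, ← h1]
  exact step

theorem IsPiecewiseSmoothLoop.intervalIntegrable_smul {γ : ℝ → ℂ}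
    (hγ : IsPiecewiseSmoothLoop γ) {f : ℂ → E} (hf : ContinuousOn f (γ '' Set.Icc 0 1)) :
    IntervalIntegrable (fun t => deriv γ t • f (γ t)) MeasureTheory.volume 0 1 := by
  refine hγ.intervalIntegrable_deriv.smul_continuousOn ?_
  rw [Set.uIcc_of_le zero_le_one]
  exact hf.comp hγ.continuousOn (Set.mapsTo_image _ _)

theorem contourIntegral_congr {γ : ℝ → ℂ} {f g : ℂ → E}
    (h : Set.EqOn f g (γ '' Set.Icc 0 1)) : contourIntegral f γ = contourIntegral g γ := by
  refine intervalIntegral.integral_congr fun t ht => ?_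
  rw [Set.uIcc_of_le zero_le_one] at ht
  simp only [h (Set.mem_image_of_mem γ ht)]

theorem norm_contourIntegral_le {γ : ℝ → ℂ} (hγ : IsPiecewiseSmoothLoop γ) {f : ℂ → E} {C : ℝ}
    (hC : ∀ w ∈ γ '' Set.Icc 0 1, ‖f w‖ ≤ C) :
    ‖contourIntegral f γ‖ ≤ C * ∫ t in (0 : ℝ)..1, ‖deriv γ t‖ := by
  rw [← intervalIntegral.integral_const_mul]
  refine intervalIntegral.norm_integral_le_of_norm_le zero_le_one (.of_forall fun t ht => ?_)
    (hγ.intervalIntegrable_deriv.norm.const_mul C)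
  rw [norm_smul, mul_comm]
  exact mul_le_mul_of_nonneg_right (hC _ ⟨t, Set.Ioc_subset_Icc_self ht, rfl⟩) (norm_nonneg _)

/-- Holomorphic dependence of a contour integral on a parameter. -/
theorem differentiableAt_contourIntegral {γ : ℝ → ℂ} (hγ : IsPiecewiseSmoothLoop γ)
    {k : ℂ → ℂ → E} {z₀ : ℂ} {r C : ℝ} (hr : 0 < r)
    (hcont : ∀ z ∈ Metric.ball z₀ r, ContinuousOn (k z) (γ '' Set.Icc 0 1))
    (hdiff : ∀ w ∈ γ '' Set.Icc 0 1, DifferentiableOn ℂ (fun z => k z w) (Metric.ball z₀ r))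
    (hC : ∀ z ∈ Metric.ball z₀ r, ∀ w ∈ γ '' Set.Icc 0 1, ‖k z w‖ ≤ C) :
    DifferentiableAt ℂ (fun z => contourIntegral (k z) γ) z₀ := by
  have hmem : ∀ t ∈ Set.uIoc (0 : ℝ) 1, γ t ∈ γ '' Set.Icc 0 1 := fun t ht => by
    rw [Set.uIoc_of_le zero_le_one] at ht
    exact ⟨t, Set.Ioc_subset_Icc_self ht, rfl⟩
  have hint : ∀ z ∈ Metric.ball z₀ r, IntervalIntegrable (fun t => deriv γ t • k z (γ t))
      MeasureTheory.volume 0 1 := fun z hz => hγ.intervalIntegrable_smul (hcont z hz)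
  have hz₀ : z₀ ∈ Metric.ball z₀ r := Metric.mem_ball_self hr
  have hderiv : ∀ t ∈ Set.uIoc (0 : ℝ) 1, ∀ z ∈ Metric.ball z₀ r,
      HasDerivAt (fun z => deriv γ t • k z (γ t)) (deriv γ t • deriv (fun z => k z (γ t)) z) z :=
    fun t ht z hz => (((hdiff _ (hmem t ht)).differentiableAt
      (Metric.isOpen_ball.mem_nhds hz)).hasDerivAt).const_smul _
  refine (intervalIntegral.hasDerivAt_integral_of_dominated_loc_of_deriv_le
    (F' := fun z t => deriv γ t • deriv (fun z => k z (γ t)) z)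
    -- Cauchy's estimate on a circle of radius `r / 4`, which stays in `ball z₀ r` when its centre
    -- lies in `ball z₀ (r / 2)`.
    (bound := fun t => ‖deriv γ t‖ * (C / (r / 4)))
    (Metric.ball_mem_nhds z₀ (half_pos hr)) ?_ (hint z₀ hz₀) ?_ (.of_forall fun t ht z hz => ?_)
    (hγ.intervalIntegrable_deriv.norm.mul_const _) (.of_forall fun t ht z hz =>
      hderiv t ht z (Metric.ball_subset_ball (by linarith) hz))).2.differentiableAt
  · filter_upwards [Metric.ball_mem_nhds z₀ hr] with z hz
    exact (hint z hz).def'.aestronglyMeasurable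
  -- Measurability in `t` of the derivative: it is the pointwise limit of measurable difference
  -- quotients along the null sequence `u`.
  · let u : ℕ → ℂ := fun n => ((r / 2 / (n + 1) : ℝ) : ℂ)
    have hu0 : ∀ n : ℕ, 0 < r / 2 / ((n : ℝ) + 1) := fun n => by positivity
    have hul : ∀ n : ℕ, r / 2 / ((n : ℝ) + 1) ≤ r / 2 := fun n =>
      div_le_self (by positivity) (by linarith [n.cast_nonneg (α := ℝ)])
    have hmem' : ∀ n, z₀ + u n ∈ Metric.ball z₀ r := fun n => by
      simp only [u, Metric.mem_ball, dist_eq_norm, add_sub_cancel_left, Complex.norm_real,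
        Real.norm_of_nonneg (hu0 n).le]
      linarith [hul n]
    have hlim : Filter.Tendsto u Filter.atTop (nhdsWithin 0 {0}ᶜ) := by
      refine tendsto_nhdsWithin_iff.2 ⟨?_, .of_forall fun n => by
        simpa [u] using (Complex.ofReal_ne_zero.2 (hu0 n).ne')⟩
      have : Filter.Tendsto (fun n : ℕ => r / 2 / ((n : ℝ) + 1)) Filter.atTop (nhds 0) :=
        Filter.Tendsto.div_atTop tendsto_const_nhds
          (tendsto_natCast_atTop_atTop.atTop_add tendsto_const_nhds)
      exact (Complex.continuous_ofReal.tendsto' 0 0 Complex.ofReal_zero).comp this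
    refine aestronglyMeasurable_of_tendsto_ae Filter.atTop
      (f := fun n t => (u n)⁻¹ • (deriv γ t • k (z₀ + u n) (γ t) - deriv γ t • k z₀ (γ t)))
      (fun n => ((hint _ (hmem' n)).def'.aestronglyMeasurable.sub
        (hint _ hz₀).def'.aestronglyMeasurable).const_smul _) ?_
    filter_upwards [MeasureTheory.ae_restrict_mem measurableSet_uIoc] with t ht
    exact (hderiv t ht z₀ hz₀).tendsto_slope_zero.comp hlim
  · rw [norm_smul]
    refine mul_le_mul_of_nonneg_left ?_ (norm_nonneg _)
    have hsub : Metric.closedBall z (r / 4) ⊆ Metric.ball z₀ r :=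
      Metric.closedBall_subset_ball' (by rw [Metric.mem_ball] at hz; linarith)
    refine Complex.norm_deriv_le_of_forall_mem_sphere_norm_le (by positivity) ?_ fun z' hz' =>
      hC z' (hsub (Metric.sphere_subset_closedBall hz')) _ (hmem t ht)
    exact DifferentiableOn.diffContOnCl
      ((hdiff _ (hmem t ht)).mono ((Metric.closure_ball_subset_closedBall).trans hsub))

end ContourIntegral

/-! ### Cauchy's integral formula for Cauchy domains. -/

/-- Difference quotients of a holomorphic function are locally uniformly bounded. -/
theorem exists_bound_dslope {E : Type*} [NormedAddCommGroup E] [NormedSpace ℂ E]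
    [CompleteSpace E] {U K : Set ℂ} (hU : IsOpen U)
    {f : ℂ → E} (hf : DifferentiableOn ℂ f U) (hK : IsCompact K) (hKU : K ⊆ U) {z₀ : ℂ}
    (hz₀ : z₀ ∈ U) :
    ∃ r C : ℝ, 0 < r ∧ Metric.ball z₀ r ⊆ U ∧
      ∀ z ∈ Metric.ball z₀ r, ∀ w ∈ K, ‖dslope f w z‖ ≤ C := by
  obtain ⟨ρ, hρ, hρU⟩ := Metric.nhds_basis_closedBall.mem_iff.1 (hU.mem_nhds hz₀)
  obtain ⟨A, hA⟩ := hK.exists_bound_of_continuousOn (hf.continuousOn.mono hKU)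
  obtain ⟨B, hB⟩ := (isCompact_closedBall z₀ ρ).exists_bound_of_continuousOn
    (hf.continuousOn.mono hρU)
  obtain ⟨M, hM⟩ := (isCompact_closedBall z₀ ρ).exists_bound_of_continuousOn
    ((hf.deriv hU).continuousOn.mono hρU)
  have hbU : Metric.ball z₀ ρ ⊆ U := Metric.ball_subset_closedBall.trans hρU
  refine ⟨ρ / 2, max M ((ρ / 2)⁻¹ * (B + A)), by positivity,
    (Metric.ball_subset_ball (by linarith)).trans hbU, fun z hz w hw => ?_⟩
  have hz' : z ∈ Metric.ball z₀ ρ := Metric.ball_subset_ball (by linarith) hz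
  -- For `w` near `z₀` the mean value inequality bounds the quotient; otherwise its denominator is
  -- at least `ρ / 2`.
  rcases lt_or_ge (dist w z₀) ρ with hwρ | hwρ
  · refine le_max_of_le_left ?_
    by_cases hzw : z = w
    · rw [hzw, dslope_same]
      exact hM w (Metric.mem_closedBall.2 hwρ.le)
    rw [dslope_of_ne _ hzw, slope_def_module, norm_smul, norm_inv]
    have h := Convex.norm_image_sub_le_of_norm_deriv_le (𝕜 := ℂ) (f := f) (s := Metric.ball z₀ ρ)
      (fun x hx => hf.differentiableAt (hU.mem_nhds (hbU hx)))
      (fun x hx => hM x (Metric.ball_subset_closedBall hx)) (convex_ball z₀ ρ)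
      (Metric.mem_ball.2 hwρ) hz'
    rw [inv_mul_le_iff₀ (norm_pos_iff.2 (sub_ne_zero.2 hzw)), mul_comm]
    exact h
  · refine le_max_of_le_right ?_
    have hd : ρ / 2 ≤ ‖z - w‖ := by
      rw [← dist_eq_norm, dist_comm]
      have := dist_triangle w z z₀
      rw [Metric.mem_ball] at hz
      linarith
    have hzw : z ≠ w := fun h => by simp [h] at hd; linarith
    rw [dslope_of_ne _ hzw, slope_def_module, norm_smul, norm_inv]
    refine mul_le_mul (inv_anti₀ (by positivity) hd) ((norm_sub_le _ _).trans
      (add_le_add (hB z (Metric.ball_subset_closedBall hz')) (hA w hw))) (norm_nonneg _)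
      (by positivity)

namespace CauchyDomain

variable {U : Set ℂ} (D : CauchyDomain U) {E : Type*} [NormedAddCommGroup E] [NormedSpace ℂ E]

theorem image_curve_subset_frontier (i : Fin D.numCurves) :
    D.curve i '' Set.Icc 0 1 ⊆ frontier D.carrier := by
  rw [D.frontier_eq]
  exact Set.subset_iUnion (fun i => D.curve i '' Set.Icc 0 1) i

theorem isCompact_frontier : IsCompact (frontier D.carrier) :=
  D.isBounded.isCompact_closure.of_isClosed_subset isClosed_frontier frontier_subset_closure

theorem frontier_subset : frontier D.carrier ⊆ U :=
  frontier_subset_closure.trans D.closure_subset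

theorem notMem_frontier {z : ℂ} (hz : z ∈ D.carrier) : z ∉ frontier D.carrier := fun h => by
  rw [D.isOpen.frontier_eq] at h
  exact h.2 hz

theorem boundaryIntegral_congr {f g : ℂ → E} (h : Set.EqOn f g (frontier D.carrier)) :
    D.boundaryIntegral f = D.boundaryIntegral g :=
  Finset.sum_congr rfl fun i _ =>
    contourIntegral_congr (h.mono (D.image_curve_subset_frontier i))

theorem boundaryIntegral_add {f g : ℂ → E} (hf : ContinuousOn f (frontier D.carrier))
    (hg : ContinuousOn g (frontier D.carrier)) :
    D.boundaryIntegral (fun ζ => f ζ + g ζ) = D.boundaryIntegral f + D.boundaryIntegral g := by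
  simp only [boundaryIntegral, ← Finset.sum_add_distrib]
  refine Finset.sum_congr rfl fun i _ => ?_
  simp only [contourIntegral, smul_add]
  exact intervalIntegral.integral_add
    ((D.loop i).intervalIntegrable_smul (hf.mono (D.image_curve_subset_frontier i)))
    ((D.loop i).intervalIntegrable_smul (hg.mono (D.image_curve_subset_frontier i)))

theorem boundaryIntegral_sub {f g : ℂ → E} (hf : ContinuousOn f (frontier D.carrier))
    (hg : ContinuousOn g (frontier D.carrier)) :
    D.boundaryIntegral (fun ζ => f ζ - g ζ) = D.boundaryIntegral f - D.boundaryIntegral g := by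
  simp only [boundaryIntegral, ← Finset.sum_sub_distrib]
  refine Finset.sum_congr rfl fun i _ => ?_
  simp only [contourIntegral, smul_sub]
  exact intervalIntegral.integral_sub
    ((D.loop i).intervalIntegrable_smul (hf.mono (D.image_curve_subset_frontier i)))
    ((D.loop i).intervalIntegrable_smul (hg.mono (D.image_curve_subset_frontier i)))

theorem boundaryIntegral_smul_const [CompleteSpace E] (f : ℂ → ℂ) (v : E) :
    D.boundaryIntegral (fun ζ => f ζ • v) = D.boundaryIntegral f • v := by
  simp only [boundaryIntegral, contourIntegral, Finset.sum_smul, ← mul_smul, smul_eq_mul,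
    intervalIntegral.integral_smul_const]

theorem boundaryIntegral_inv_sub_of_mem {z : ℂ} (hz : z ∈ D.carrier) :
    D.boundaryIntegral (fun ζ => (ζ - z)⁻¹) = 2 * Real.pi * Complex.I :=
  ((inv_mul_eq_one₀ Complex.two_pi_I_ne_zero).1 (D.winding_inside z hz)).symm

theorem boundaryIntegral_inv_sub_of_notMem {z : ℂ} (hz : z ∉ closure D.carrier) :
    D.boundaryIntegral (fun ζ => (ζ - z)⁻¹) = 0 :=
  (mul_eq_zero.1 (D.winding_outside z hz)).resolve_left (inv_ne_zero Complex.two_pi_I_ne_zero)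

theorem continuousOn_inv_sub {z : ℂ} (hz : z ∉ frontier D.carrier) :
    ContinuousOn (fun ζ => (ζ - z)⁻¹) (frontier D.carrier) :=
  (continuousOn_id.sub continuousOn_const).inv₀ fun ζ hζ h => hz ((sub_eq_zero.1 h : ζ = z) ▸ hζ)

theorem continuousOn_inv_sub_smul {f : ℂ → E} (hf : ContinuousOn f U) {z : ℂ}
    (hz : z ∉ frontier D.carrier) :
    ContinuousOn (fun ζ => (ζ - z)⁻¹ • f ζ) (frontier D.carrier) :=
  (D.continuousOn_inv_sub hz).smul (hf.mono D.frontier_subset)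

theorem boundaryIntegral_dslope [CompleteSpace E] {f : ℂ → E} (hf : ContinuousOn f U) {z : ℂ}
    (hz : z ∉ frontier D.carrier) :
    D.boundaryIntegral (fun ζ => dslope f ζ z) =
      D.boundaryIntegral (fun ζ => (ζ - z)⁻¹ • f ζ) -
        D.boundaryIntegral (fun ζ => (ζ - z)⁻¹) • f z := by
  rw [← D.boundaryIntegral_smul_const, ← D.boundaryIntegral_sub
    (D.continuousOn_inv_sub_smul hf hz)
    (g := fun ζ => (ζ - z)⁻¹ • f z) ((D.continuousOn_inv_sub hz).smul continuousOn_const)]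
  refine D.boundaryIntegral_congr fun ζ hζ => ?_
  have hne : z ≠ ζ := fun h => hz (h ▸ hζ)
  rw [dslope_of_ne _ hne, slope_comm, slope_def_module, smul_sub]

/-- The kernel has no singularity at `ζ = z`, so points on the boundary curves are covered too. -/
theorem differentiableAt_boundaryIntegral_dslope [CompleteSpace E] (hU : IsOpen U) {f : ℂ → E}
    (hf : DifferentiableOn ℂ f U) {z₀ : ℂ} (hz₀ : z₀ ∈ U) :
    DifferentiableAt ℂ (fun z => D.boundaryIntegral fun ζ => dslope f ζ z) z₀ := by
  obtain ⟨r, C, hr, hrU, hC⟩ := exists_bound_dslope hU hf D.isCompact_frontier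
    D.frontier_subset hz₀
  refine DifferentiableAt.fun_sum fun i _ => ?_
  have hi := D.image_curve_subset_frontier i
  refine differentiableAt_contourIntegral (D.loop i) (C := C) hr (fun z hz => ?_)
    (fun w hw => ?_) fun z hz w hw => hC z hz w (hi hw)
  · have hzU := hU.mem_nhds (hrU hz)
    -- The difference quotient is symmetric in its two points, so continuity in `ζ` reduces to that
    -- of `dslope f z`.
    have := (continuousOn_dslope hzU).2 ⟨hf.continuousOn, hf.differentiableAt hzU⟩
    refine (this.mono (hi.trans D.frontier_subset)).congr fun ζ _ => ?_
    by_cases h : z = ζ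
    · rw [h]
    · rw [dslope_of_ne _ h, dslope_of_ne _ (Ne.symm h), slope_comm]
  · exact ((Complex.differentiableOn_dslope
      (hU.mem_nhds (D.frontier_subset (hi hw)))).2 hf).mono hrU

theorem differentiableAt_boundaryIntegral_inv_sub_smul {f : ℂ → E} (hf : ContinuousOn f U)
    {z₀ : ℂ} (hz₀ : z₀ ∉ closure D.carrier) :
    DifferentiableAt ℂ (fun z => D.boundaryIntegral fun ζ => (ζ - z)⁻¹ • f ζ) z₀ := by
  obtain ⟨r, hr, hsub⟩ := Metric.isOpen_iff.1 isClosed_closure.isOpen_compl z₀ hz₀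
  obtain ⟨A, hA⟩ := D.isCompact_frontier.exists_bound_of_continuousOn
    (hf.mono D.frontier_subset)
  have hball : ∀ z ∈ Metric.ball z₀ (r / 2), ∀ w ∈ frontier D.carrier, r / 2 ≤ ‖w - z‖ := by
    intro z hz w hw
    have h1 : r ≤ dist w z₀ := by
      by_contra! h
      exact hsub (Metric.mem_ball.2 h) (frontier_subset_closure hw)
    have := dist_triangle w z z₀
    rw [Metric.mem_ball] at hz
    rw [← dist_eq_norm]
    linarith
  have hne : ∀ z ∈ Metric.ball z₀ (r / 2), ∀ w ∈ frontier D.carrier, w - z ≠ 0 :=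
    fun z hz w hw h => by
      have := hball z hz w hw
      rw [h, norm_zero] at this
      linarith
  refine DifferentiableAt.fun_sum fun i _ => ?_
  have hi := D.image_curve_subset_frontier i
  refine differentiableAt_contourIntegral (D.loop i) (C := (r / 2)⁻¹ * A) (half_pos hr)
    (fun z hz => ?_) (fun w hw => ?_) fun z hz w hw => ?_
  · exact (D.continuousOn_inv_sub_smul hf fun h => hne z hz z h (sub_self z)).mono hi
  · exact ((differentiableOn_const w).sub differentiableOn_id).inv
      (fun z hz => hne z hz w (hi hw)) |>.smul_const _
  · rw [norm_smul, norm_inv]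
    exact mul_le_mul (inv_anti₀ (by positivity) (hball z hz w (hi hw))) (hA w (hi hw))
      (norm_nonneg _) (by positivity)

theorem tendsto_boundaryIntegral_inv_sub_smul {f : ℂ → E} (hf : ContinuousOn f U) :
    Filter.Tendsto (fun z => D.boundaryIntegral fun ζ => (ζ - z)⁻¹ • f ζ)
      (Filter.cocompact ℂ) (nhds 0) := by
  obtain ⟨A, hA⟩ := D.isCompact_frontier.exists_bound_of_continuousOn
    (hf.mono D.frontier_subset)
  obtain ⟨R, hR⟩ := D.isCompact_frontier.isBounded.exists_norm_le
  rw [← Finset.sum_const_zero (s := (Finset.univ : Finset (Fin D.numCurves)))]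
  refine tendsto_finsetSum _ fun i _ => ?_
  have hi := D.image_curve_subset_frontier i
  have hinv : Filter.Tendsto (fun z : ℂ => (‖z‖ - R)⁻¹) (Filter.cocompact ℂ) (nhds 0) :=
    (Filter.tendsto_atTop_add_const_right _ (-R) tendsto_norm_cocompact_atTop).inv_tendsto_atTop
  refine squeeze_zero_norm' (a := fun z => (‖z‖ - R)⁻¹ * A *
    ∫ t in (0 : ℝ)..1, ‖deriv (D.curve i) t‖) ?_ ?_
  · filter_upwards [tendsto_norm_cocompact_atTop.eventually_gt_atTop R] with z hz
    refine norm_contourIntegral_le (D.loop i) fun w hw => ?_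
    rw [norm_smul, norm_inv]
    have h1 : ‖z‖ - R ≤ ‖w - z‖ := by
      have := norm_sub_norm_le z w
      rw [norm_sub_rev] at this
      linarith [hR w (hi hw)]
    exact mul_le_mul (inv_anti₀ (by linarith) h1) (hA w (hi hw)) (norm_nonneg _)
      (inv_nonneg.2 (by linarith))
  · simpa using (hinv.mul_const A).mul_const (∫ t in (0 : ℝ)..1, ‖deriv (D.curve i) t‖)

/-- Dixon's argument: `U` and the complement of `closure D.carrier` are open and cover the plane,
and the two holomorphic branches of `h` glue. The outer branch tends to `0` at infinity, so
Liouville's theorem applies. -/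
theorem boundaryIntegral_dslope_eq_zero [CompleteSpace E] (hU : IsOpen U) {f : ℂ → E}
    (hf : DifferentiableOn ℂ f U) {z : ℂ} (hz : z ∈ U) :
    (D.boundaryIntegral fun ζ => dslope f ζ z) = 0 := by
  classical
  let h : ℂ → E := fun z => if z ∈ U then D.boundaryIntegral fun ζ => dslope f ζ z
    else D.boundaryIntegral fun ζ => (ζ - z)⁻¹ • f ζ
  -- The branches agree on the overlap because the winding number vanishes there.
  have hout : ∀ z ∉ closure D.carrier,
      h z = D.boundaryIntegral fun ζ => (ζ - z)⁻¹ • f ζ := by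
    intro z hz
    by_cases hzU : z ∈ U
    · simp only [h, if_pos hzU]
      rw [D.boundaryIntegral_dslope hf.continuousOn fun h => hz (frontier_subset_closure h),
        D.boundaryIntegral_inv_sub_of_notMem hz, zero_smul, sub_zero]
    · simp only [h, if_neg hzU]
  have hentire : Differentiable ℂ h := by
    intro z
    by_cases hzU : z ∈ U
    · refine (D.differentiableAt_boundaryIntegral_dslope hU hf hzU).congr_of_eventuallyEq ?_
      filter_upwards [hU.mem_nhds hzU] with w hw
      simp only [h, if_pos hw]
    · have hzc : z ∉ closure D.carrier := fun h => hzU (D.closure_subset h)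
      refine (D.differentiableAt_boundaryIntegral_inv_sub_smul hf.continuousOn
        hzc).congr_of_eventuallyEq ?_
      filter_upwards [isClosed_closure.isOpen_compl.mem_nhds hzc] with w hw
      exact hout w hw
  have hlim : Filter.Tendsto h (Filter.cocompact ℂ) (nhds 0) := by
    refine (D.tendsto_boundaryIntegral_inv_sub_smul hf.continuousOn).congr' ?_
    filter_upwards [D.isBounded.isCompact_closure.compl_mem_cocompact] with w hw
    exact (hout w hw).symm
  have := hentire.apply_eq_of_tendsto_cocompact z hlim
  simpa only [h, if_pos hz] using this

/-- Cauchy's integral formula for Cauchy domains. -/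
theorem boundaryIntegral_inv_sub_smul [CompleteSpace E] (hU : IsOpen U) {f : ℂ → E}
    (hf : DifferentiableOn ℂ f U) {z : ℂ} (hz : z ∈ D.carrier) :
    (D.boundaryIntegral fun ζ => (ζ - z)⁻¹ • f ζ) = (2 * Real.pi * Complex.I : ℂ) • f z := by
  have h := D.boundaryIntegral_dslope hf.continuousOn (D.notMem_frontier hz)
  rw [D.boundaryIntegral_dslope_eq_zero hU hf (D.closure_subset (subset_closure hz)),
    D.boundaryIntegral_inv_sub_of_mem hz] at h
  exact (sub_eq_zero.1 h.symm)

end CauchyDomain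

/-! ### Cauchy domains made of discs. -/

section Discs

theorem isPiecewiseSmoothLoop_circleMap (c : ℂ) (r : ℝ) :
    IsPiecewiseSmoothLoop fun t => circleMap c r (2 * Real.pi * t) := by
  have hsmooth : ContDiff ℝ 1 fun t => circleMap c r (2 * Real.pi * t) :=
    (contDiff_circleMap c r).comp (contDiff_const.mul contDiff_id)
  refine ⟨hsmooth.continuous.continuousOn, ?_, 1, ![0, 1], ?_, rfl, rfl,
    fun k => hsmooth.contDiffOn⟩
  · simp [circleMap]
  · intro i j hij
    fin_cases i <;> fin_cases j <;> simp_all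

theorem contourIntegral_circleMap {E : Type*} [NormedAddCommGroup E] [NormedSpace ℂ E]
    (f : ℂ → E) (c : ℂ) (r : ℝ) :
    contourIntegral f (fun t => circleMap c r (2 * Real.pi * t)) = ∮ z in C(c, r), f z := by
  have h := intervalIntegral.smul_integral_comp_mul_left (a := 0) (b := 1)
    (fun θ => deriv (circleMap c r) θ • f (circleMap c r θ)) (2 * Real.pi)
  rw [mul_zero, mul_one] at h
  rw [circleIntegral, ← h, contourIntegral, ← intervalIntegral.integral_smul]
  refine intervalIntegral.integral_congr fun t _ => ?_
  simp only [deriv_comp_mul_left, smul_assoc]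

theorem image_circleMap_Icc (c : ℂ) {r : ℝ} (hr : 0 ≤ r) :
    (fun t => circleMap c r (2 * Real.pi * t)) '' Set.Icc 0 1 = Metric.sphere c r := by
  apply Set.Subset.antisymm
  · rintro _ ⟨t, -, rfl⟩
    exact circleMap_mem_sphere c hr _
  · intro z hz
    rw [← abs_of_nonneg hr, ← image_circleMap_Ioc] at hz
    obtain ⟨θ, hθ, rfl⟩ := hz
    refine ⟨θ / (2 * Real.pi), ⟨div_nonneg hθ.1.le Real.two_pi_pos.le,
      (div_le_one Real.two_pi_pos).2 hθ.2⟩, ?_⟩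
    simp only [mul_div_cancel₀ θ Real.two_pi_pos.ne']

theorem circleIntegral_inv_sub_of_notMem_closedBall {c z : ℂ} {r : ℝ} (hr : 0 ≤ r)
    (hz : z ∉ Metric.closedBall c r) : (∮ w in C(c, r), (w - z)⁻¹) = 0 := by
  refine DiffContOnCl.circleIntegral_eq_zero hr (DifferentiableOn.diffContOnCl ?_)
  refine (differentiableOn_id.sub (differentiableOn_const z)).inv fun w hw h => hz ?_
  rw [← (sub_eq_zero.1 h : w = z)]
  exact Metric.closure_ball_subset_closedBall hw

/-- The union of finitely many discs of the same radius with disjoint closures. -/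
noncomputable def CauchyDomain.ofDiscs {U : Set ℂ} {n : ℕ} (c : Fin n → ℂ) {r : ℝ} (hr : 0 < r)
    (hdisj : Pairwise fun i j => Disjoint (Metric.closedBall (c i) r) (Metric.closedBall (c j) r))
    (hU : ∀ i, Metric.closedBall (c i) r ⊆ U) : CauchyDomain U where
  carrier := ⋃ i, Metric.ball (c i) r
  isOpen := isOpen_iUnion fun _ => Metric.isOpen_ball
  isBounded := (Bornology.isBounded_iUnion).2 fun _ => Metric.isBounded_ball
  closure_subset := by
    rw [closure_iUnion_of_finite]
    exact Set.iUnion_subset fun i => Metric.closure_ball_subset_closedBall.trans (hU i)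
  numCurves := n
  curve i t := circleMap (c i) r (2 * Real.pi * t)
  loop i := isPiecewiseSmoothLoop_circleMap (c i) r
  frontier_eq := by
    rw [(isOpen_iUnion fun _ => Metric.isOpen_ball).frontier_eq, closure_iUnion_of_finite]
    simp only [closure_ball _ hr.ne', image_circleMap_Icc _ hr.le]
    ext z
    simp only [Set.mem_sdiff, Set.mem_iUnion, not_exists]
    constructor
    · rintro ⟨⟨i, hi⟩, h⟩
      exact ⟨i, le_antisymm hi (not_lt.1 (h i))⟩
    · rintro ⟨i, hi⟩
      refine ⟨⟨i, Metric.sphere_subset_closedBall hi⟩, fun j hj => ?_⟩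
      by_cases hij : i = j
      · subst hij
        exact (Metric.mem_ball.1 hj).ne hi
      · exact Set.disjoint_left.1 (hdisj hij) (Metric.sphere_subset_closedBall hi)
          (Metric.ball_subset_closedBall hj)
  winding_inside := by
    intro z hz
    obtain ⟨i, hi⟩ := Set.mem_iUnion.1 hz
    simp only [contourIntegral_circleMap]
    -- Only the circle around the disc containing `z` contributes.
    rw [Finset.sum_eq_single i (fun j _ hij => circleIntegral_inv_sub_of_notMem_closedBall hr.le
      (Set.disjoint_left.1 (hdisj hij.symm) (Metric.ball_subset_closedBall hi)))
      (fun h => (h (Finset.mem_univ i)).elim), circleIntegral.integral_sub_inv_of_mem_ball hi]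
    exact inv_mul_cancel₀ Complex.two_pi_I_ne_zero
  winding_outside := by
    intro z hz
    rw [closure_iUnion_of_finite] at hz
    simp only [closure_ball _ hr.ne', Set.mem_iUnion, not_exists] at hz
    simp only [contourIntegral_circleMap]
    rw [Finset.sum_eq_zero fun i _ => circleIntegral_inv_sub_of_notMem_closedBall hr.le (hz i),
      mul_zero]

/-- The pair is to be the spectrum of a quaternion; `a = b` is the case of a real one, for which a
single disc suffices. -/
theorem exists_cauchyDomain_pair_subset {U : Set ℂ} (hU : IsOpen U) {a b : ℂ} (ha : a ∈ U)
    (hb : b ∈ U) : ∃ D : CauchyDomain U, {a, b} ⊆ D.carrier := by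
  obtain ⟨r₁, hr₁, h₁⟩ := Metric.nhds_basis_closedBall.mem_iff.1 (hU.mem_nhds ha)
  obtain ⟨r₂, hr₂, h₂⟩ := Metric.nhds_basis_closedBall.mem_iff.1 (hU.mem_nhds hb)
  by_cases hab : a = b
  · subst hab
    refine ⟨CauchyDomain.ofDiscs (n := 1) (fun _ => a) hr₁
      (fun i j h => (h (Subsingleton.elim i j)).elim) fun _ => h₁, ?_⟩
    rw [Set.pair_eq_singleton, Set.singleton_subset_iff]
    exact Set.mem_iUnion.2 ⟨0, Metric.mem_ball_self hr₁⟩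
  · have hd : 0 < dist a b := dist_pos.2 hab
    -- A third of the distance keeps the two closed discs disjoint.
    have hr : 0 < min (min r₁ r₂) (dist a b / 3) := by positivity
    set r := min (min r₁ r₂) (dist a b / 3) with hrdef
    have hr3 : r ≤ dist a b / 3 := min_le_right _ _
    have hdis : Disjoint (Metric.closedBall a r) (Metric.closedBall b r) :=
      Metric.closedBall_disjoint_closedBall (by linarith)
    refine ⟨CauchyDomain.ofDiscs (n := 2) ![a, b] hr ?_ ?_, ?_⟩
    · intro i j hij
      fin_cases i <;> fin_cases j
      · exact (hij rfl).elim
      · exact hdis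
      · exact hdis.symm
      · exact (hij rfl).elim
    · intro i
      fin_cases i
      · exact (Metric.closedBall_subset_closedBall
          ((min_le_left _ _).trans (min_le_left _ _))).trans h₁
      · exact (Metric.closedBall_subset_closedBall
          ((min_le_left _ _).trans (min_le_right _ _))).trans h₂
    · rintro z (rfl | rfl)
      · exact Set.mem_iUnion.2 ⟨0, Metric.mem_ball_self hr⟩
      · exact Set.mem_iUnion.2 ⟨1, Metric.mem_ball_self hr⟩

end Discs

/-! ### Idempotents of `𝕄` attached to imaginary units. -/

namespace BiQuat

instance : FiniteDimensional ℂ BiQuat :=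
  FiniteDimensional.of_injective toMatrix.toLinearMap toMatrix_injective

instance : CompleteSpace BiQuat := FiniteDimensional.complete ℂ BiQuat

/-- The inclusion `ℍ ⊂ 𝕄` as a continuous real-linear map. -/
noncomputable def ofQuatCLM : Quaternion ℝ →L[ℝ] BiQuat :=
  LinearMap.toContinuousLinearMap
    { toFun := ofQuat
      map_add' := map_add ofQuat
      map_smul' := fun r q => by
        have h (a : ℝ) : ((r • a : ℝ) : ℂ) = r * a := Complex.ofReal_mul r a
        exact QuaternionAlgebra.ext (h q.re) (h q.imI) (h q.imJ) (h q.imK) }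

@[simp] theorem ofQuatCLM_apply (q : Quaternion ℝ) : ofQuatCLM q = ofQuat q := rfl

theorem ofQuat_smul (r : ℝ) (q : Quaternion ℝ) : ofQuat (r • q) = (r : ℂ) • ofQuat q :=
  ofQuatCLM.map_smul r q

theorem ofQuat_coe (r : ℝ) : ofQuat (r : Quaternion ℝ) = (r : ℂ) • 1 := by
  rw [← mul_one (r : Quaternion ℝ), Quaternion.coe_mul_eq_smul, ofQuat_smul, map_one]

/-- The element `(1 - i s) / 2` of `𝕄`, which is idempotent when `s ∈ 𝕊`. -/
noncomputable def halfProj (s : Quaternion ℝ) : BiQuat := (1 / 2 : ℂ) • (1 - Complex.I • ofQuat s)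

theorem halfProj_neg (s : Quaternion ℝ) :
    halfProj (-s) = (1 / 2 : ℂ) • (1 + Complex.I • ofQuat s) := by
  rw [halfProj, map_neg, smul_neg, sub_neg_eq_add]

theorem halfProj_add_halfProj_neg (s : Quaternion ℝ) : halfProj s + halfProj (-s) = 1 := by
  rw [halfProj_neg, halfProj]
  module

/-- A linear identity that does not need `s² = -1`; at real quaternions it is also applied with `s =
0`. -/
theorem ofQuat_add_smul (x y : ℝ) (s : Quaternion ℝ) :
    ofQuat (x + y • s) = (x + y * Complex.I : ℂ) • halfProj s +
      (x - y * Complex.I : ℂ) • halfProj (-s) := by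
  rw [map_add, ofQuat_coe, ofQuat_smul, halfProj_neg, halfProj]
  match_scalars
  · ring
  · linear_combination (y : ℂ) * Complex.I_mul_I

theorem ofQuat_mul_self {s : Quaternion ℝ} (hs : s ∈ imagUnits) : ofQuat s * ofQuat s = -1 := by
  have h := Quaternion.sq_eq_neg_normSq.2 hs.1
  rw [Quaternion.normSq_eq_norm_mul_self, hs.2, mul_one, Quaternion.coe_one, pow_two] at h
  rw [← map_mul, h, map_neg, map_one]

/-- On the left ideal `𝕄 * halfProj s`, right multiplication by `s` becomes the central scalar `i`.
-/
theorem halfProj_mul_ofQuat {s : Quaternion ℝ} (hs : s ∈ imagUnits) :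
    halfProj s * ofQuat s = Complex.I • halfProj s := by
  simp only [halfProj, smul_mul_assoc, sub_mul, one_mul, ofQuat_mul_self hs]
  match_scalars
  · linear_combination (1 / 2 : ℂ) * Complex.I_mul_I
  · ring

theorem neg_mem_imagUnits {s : Quaternion ℝ} (hs : s ∈ imagUnits) : -s ∈ imagUnits :=
  ⟨by simp [hs.1], by rw [norm_neg, hs.2]⟩

theorem halfProj_neg_mul_ofQuat {s : Quaternion ℝ} (hs : s ∈ imagUnits) :
    halfProj (-s) * ofQuat s = -(Complex.I • halfProj (-s)) := by
  rw [← halfProj_mul_ofQuat (neg_mem_imagUnits hs), map_neg, mul_neg, neg_neg]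

theorem halfProj_mul_halfProj {s : Quaternion ℝ} (hs : s ∈ imagUnits) :
    halfProj s * halfProj s = halfProj s := by
  rw [show halfProj s * halfProj s
    = halfProj s * ((1 / 2 : ℂ) • (1 - Complex.I • ofQuat s)) from rfl, mul_smul_comm, mul_sub,
    mul_smul_comm, halfProj_mul_ofQuat hs, mul_one]
  match_scalars
  linear_combination (-1 / 2 : ℂ) * Complex.I_mul_I

theorem halfProj_mul_halfProj_neg {s : Quaternion ℝ} (hs : s ∈ imagUnits) :
    halfProj s * halfProj (-s) = 0 := by
  rw [halfProj_neg, mul_smul_comm, mul_add, mul_smul_comm, halfProj_mul_ofQuat hs, mul_one]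
  match_scalars
  linear_combination (1 / 2 : ℂ) * Complex.I_mul_I

theorem halfProj_neg_mul_halfProj {s : Quaternion ℝ} (hs : s ∈ imagUnits) :
    halfProj (-s) * halfProj s = 0 := by
  simpa using halfProj_mul_halfProj_neg (neg_mem_imagUnits hs)

/-- Its quaternionic real part is `1 / 2`. -/
theorem halfProj_ne_zero {s : Quaternion ℝ} (hs : s ∈ imagUnits) : halfProj s ≠ 0 := by
  intro h
  obtain ⟨v, hv, hvre⟩ : ∃ v : Quaternion ℂ, v = ofQuat s ∧ v.re = s.re := ⟨ofQuat s, rfl, rfl⟩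
  have hre : ((1 / 2 : ℂ) • ((1 : Quaternion ℂ) - Complex.I • v)).re = 0 := by
    rw [hv]
    exact congrArg (fun a : Quaternion ℂ => a.re) h
  simp [hvre, hs.1, Quaternion.re_one] at hre

theorem smul_halfProj_add_mul {s : Quaternion ℝ} (hs : s ∈ imagUnits) (a b c d : ℂ) :
    (a • halfProj s + b • halfProj (-s)) * (c • halfProj s + d • halfProj (-s)) =
      (a * c) • halfProj s + (b * d) • halfProj (-s) := by
  simp only [mul_add, add_mul, smul_mul_smul_comm, halfProj_mul_halfProj hs,
    halfProj_mul_halfProj (neg_mem_imagUnits hs), halfProj_mul_halfProj_neg hs,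
    halfProj_neg_mul_halfProj hs, smul_zero, add_zero, zero_add]

theorem algebraMap_sub_ofQuat (ζ : ℂ) (x y : ℝ) (s : Quaternion ℝ) :
    algebraMap ℂ BiQuat ζ - ofQuat (x + y • s) =
      (ζ - (x + y * Complex.I)) • halfProj s + (ζ - (x - y * Complex.I)) • halfProj (-s) := by
  rw [Algebra.algebraMap_eq_smul_one, ← halfProj_add_halfProj_neg s, ofQuat_add_smul]
  module

theorem inverse_smul_halfProj_add {s : Quaternion ℝ} (hs : s ∈ imagUnits) {a b : ℂ}
    (ha : a ≠ 0) (hb : b ≠ 0) :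
    IsUnit (a • halfProj s + b • halfProj (-s)) ∧
      Ring.inverse (a • halfProj s + b • halfProj (-s)) =
        a⁻¹ • halfProj s + b⁻¹ • halfProj (-s) := by
  have h₁ := smul_halfProj_add_mul hs a b a⁻¹ b⁻¹
  have h₂ := smul_halfProj_add_mul hs a⁻¹ b⁻¹ a b
  rw [mul_inv_cancel₀ ha, mul_inv_cancel₀ hb, one_smul, one_smul,
    halfProj_add_halfProj_neg] at h₁
  rw [inv_mul_cancel₀ ha, inv_mul_cancel₀ hb, one_smul, one_smul,
    halfProj_add_halfProj_neg] at h₂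
  exact ⟨⟨⟨_, _, h₁, h₂⟩, rfl⟩, Ring.inverse_unit ⟨_, _, h₁, h₂⟩⟩

end BiQuat

/-! ### Spectra of quaternions and the set `U_ℍ`. -/

open BiQuat

theorem quatSpectrum_add_smul {s : Quaternion ℝ} (hs : s ∈ imagUnits) (x y : ℝ) :
    quatSpectrum (x + y • s) = {(x + y * Complex.I : ℂ), (x - y * Complex.I : ℂ)} := by
  ext ζ
  rw [quatSpectrum, spectrum.mem_iff, algebraMap_sub_ofQuat, Set.mem_insert_iff,
    Set.mem_singleton_iff]
  constructor
  · intro h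
    by_contra! hne
    exact h (inverse_smul_halfProj_add hs (sub_ne_zero.2 hne.1) (sub_ne_zero.2 hne.2)).1
  · rintro (h | h) hu
    · rw [h, sub_self, zero_smul, zero_add] at hu
      -- What remains is a multiple of `halfProj (-s)`; `halfProj s` annihilates it from the left,
      -- so it is not a unit.
      refine halfProj_ne_zero hs (hu.mul_right_cancel ?_)
      rw [mul_smul_comm, halfProj_mul_halfProj_neg hs, smul_zero, zero_mul]
    · rw [h, sub_self, zero_smul, add_zero] at hu
      refine halfProj_ne_zero (neg_mem_imagUnits hs) (hu.mul_right_cancel ?_)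
      rw [mul_smul_comm, halfProj_neg_mul_halfProj hs, smul_zero, zero_mul]

/-- For real `q` the convention `0⁻¹ = 0` makes the normalized direction `0`, so no case is
excluded. -/
theorem add_smul_normalized_im (q : Quaternion ℝ) :
    (q.re : Quaternion ℝ) + ‖q.im‖ • (‖q.im‖⁻¹ • q.im) = q := by
  by_cases h : q.im = 0
  · conv_rhs => rw [← Quaternion.re_add_im q, h]
    simp [h]
  · rw [smul_inv_smul₀ (norm_ne_zero_iff.2 h), Quaternion.re_add_im]

theorem normalized_im_mem_imagUnits {q : Quaternion ℝ} (h : q.im ≠ 0) :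
    ‖q.im‖⁻¹ • q.im ∈ imagUnits :=
  ⟨by simp, norm_smul_inv_norm h⟩

theorem exists_imagUnits_eq_add_smul (q : Quaternion ℝ) :
    ∃ s ∈ imagUnits, q = (q.re : Quaternion ℝ) + ‖q.im‖ • s := by
  by_cases h : q.im = 0
  -- The coefficient of `s` is `0`, so any imaginary unit would serve.
  · obtain ⟨s, h₀, h₁, h₂, h₃⟩ : ∃ s : Quaternion ℝ,
        s.re = 0 ∧ s.imI = 1 ∧ s.imJ = 0 ∧ s.imK = 0 := ⟨⟨0, 1, 0, 0⟩, rfl, rfl, rfl, rfl⟩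
    refine ⟨s, ⟨h₀, ?_⟩, ?_⟩
    · rw [← sq_eq_sq₀ (norm_nonneg _) zero_le_one, pow_two, ← Quaternion.normSq_eq_norm_mul_self,
        Quaternion.normSq_def', h₀, h₁, h₂, h₃]
      norm_num
    · conv_lhs => rw [← Quaternion.re_add_im q, h]
      simp [h]
  · exact ⟨_, normalized_im_mem_imagUnits h, (add_smul_normalized_im q).symm⟩

theorem IsConjSymm.sub_mem_iff {U : Set ℂ} (hU : IsConjSymm U) (x y : ℝ) :
    (x - y * Complex.I : ℂ) ∈ U ↔ (x + y * Complex.I : ℂ) ∈ U := by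
  rw [hU (x + y * Complex.I)]
  simp [sub_eq_add_neg]

theorem add_smul_mem_quatSet {U : Set ℂ} (hU : IsConjSymm U) {s : Quaternion ℝ}
    (hs : s ∈ imagUnits) (x y : ℝ) :
    (x : Quaternion ℝ) + y • s ∈ quatSet U ↔ (x + y * Complex.I : ℂ) ∈ U := by
  rw [quatSet, Set.mem_ofPred_eq, quatSpectrum_add_smul hs, Set.insert_subset_iff,
    Set.singleton_subset_iff, hU.sub_mem_iff, and_self_iff]

/-- By conjugate symmetry one of the two conjugate spectral points decides membership. -/
theorem mem_quatSet_iff {U : Set ℂ} (hU : IsConjSymm U) (q : Quaternion ℝ) :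
    q ∈ quatSet U ↔ (q.re + ‖q.im‖ * Complex.I : ℂ) ∈ U := by
  obtain ⟨s, hs, hq⟩ := exists_imagUnits_eq_add_smul q
  conv_lhs => rw [hq]
  exact add_smul_mem_quatSet hU hs _ _

theorem isOpen_quatSet {U : Set ℂ} (hU : IsOpen U) (hsymm : IsConjSymm U) :
    IsOpen (quatSet U) := by
  have : quatSet U =
      (fun q : Quaternion ℝ => (q.re + ‖q.im‖ * Complex.I : ℂ)) ⁻¹' U :=
    Set.ext (mem_quatSet_iff hsymm)
  rw [this]
  refine hU.preimage ?_
  have h₁ := Quaternion.continuous_re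
  have h₂ := Quaternion.continuous_im
  fun_prop

/-! ### The closed formula for the Cauchy transform. -/

/-- The value at `q = x + y s` of the slice regular function with stem `F`. -/
noncomputable def stemValue (F : ℂ → BiQuat) (x y : ℝ) (s : Quaternion ℝ) : BiQuat :=
  F (x + y * Complex.I) * halfProj s + F (x - y * Complex.I) * halfProj (-s)

theorem stemValue_zero (F : ℂ → BiQuat) (x : ℝ) (s : Quaternion ℝ) :
    stemValue F x 0 s = F x := by
  simp [stemValue, ← mul_add, halfProj_add_halfProj_neg]

/-- The resolvent is diagonal along the idempotents, so Cauchy's formula applies to `F * halfProj s`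
and `F * halfProj (-s)` separately. -/
theorem cauchyIntegral_add_smul {U : Set ℂ} (hU : IsOpen U) {F : ℂ → BiQuat}
    (hF : DifferentiableOn ℂ F U) (D : CauchyDomain U) {s : Quaternion ℝ} (hs : s ∈ imagUnits)
    {x y : ℝ} (hD : quatSpectrum (x + y • s) ⊆ D.carrier) :
    cauchyIntegral D F (x + y • s) = stemValue F x y s := by
  rw [quatSpectrum_add_smul hs, Set.insert_subset_iff, Set.singleton_subset_iff] at hD
  have hdiff : ∀ p : BiQuat, DifferentiableOn ℂ (fun ζ => F ζ * p) U :=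
    fun p => hF.mul_const p
  have hfr := fun {z : ℂ} (hz : z ∈ D.carrier) => D.notMem_frontier hz
  have hcongr : Set.EqOn
      (fun ζ => F ζ * Ring.inverse (algebraMap ℂ BiQuat ζ - ofQuat (x + y • s)))
      (fun ζ => (ζ - (x + y * Complex.I))⁻¹ • (F ζ * halfProj s) +
        (ζ - (x - y * Complex.I))⁻¹ • (F ζ * halfProj (-s))) (frontier D.carrier) := by
    intro ζ hζ
    have hne : ∀ {z : ℂ}, z ∈ D.carrier → ζ - z ≠ 0 := fun hz h =>
      hfr hz ((sub_eq_zero.1 h) ▸ hζ)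
    simp only
    rw [algebraMap_sub_ofQuat, (inverse_smul_halfProj_add hs (hne hD.1) (hne hD.2)).2, mul_add,
      mul_smul_comm, mul_smul_comm]
  rw [cauchyIntegral, D.boundaryIntegral_congr hcongr, D.boundaryIntegral_add
    (D.continuousOn_inv_sub_smul (hdiff _).continuousOn (hfr hD.1))
    (D.continuousOn_inv_sub_smul (hdiff _).continuousOn (hfr hD.2)),
    D.boundaryIntegral_inv_sub_smul hU (hdiff _) hD.1,
    D.boundaryIntegral_inv_sub_smul hU (hdiff _) hD.2, ← smul_add,
    inv_smul_smul₀ Complex.two_pi_I_ne_zero, stemValue]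

theorem exists_cauchyDomain_quatSpectrum_subset {U : Set ℂ} (hU : IsOpen U)
    {q : Quaternion ℝ} (hq : q ∈ quatSet U) :
    ∃ D : CauchyDomain U, quatSpectrum q ⊆ D.carrier := by
  obtain ⟨s, hs, hqs⟩ := exists_imagUnits_eq_add_smul q
  rw [quatSet, Set.mem_ofPred_eq, hqs, quatSpectrum_add_smul hs, Set.insert_subset_iff,
    Set.singleton_subset_iff] at hq
  rw [hqs, quatSpectrum_add_smul hs]
  exact exists_cauchyDomain_pair_subset hU hq.1 hq.2

theorem cauchyTransform_add_smul {U : Set ℂ} (hU : IsOpen U) {F : ℂ → BiQuat}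
    (hF : DifferentiableOn ℂ F U) {s : Quaternion ℝ} (hs : s ∈ imagUnits) {x y : ℝ}
    (hq : (x : Quaternion ℝ) + y • s ∈ quatSet U) :
    cauchyTransform U F (x + y • s) = stemValue F x y s := by
  have h := exists_cauchyDomain_quatSpectrum_subset hU hq
  rw [cauchyTransform, dif_pos h]
  exact cauchyIntegral_add_smul hU hF _ hs h.choose_spec

theorem cauchyTransform_eq_cauchyIntegral {U : Set ℂ} (hU : IsOpen U) {F : ℂ → BiQuat}
    (hF : DifferentiableOn ℂ F U) {q : Quaternion ℝ} (hq : q ∈ quatSet U) (D : CauchyDomain U)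
    (hD : quatSpectrum q ⊆ D.carrier) : cauchyTransform U F q = cauchyIntegral D F q := by
  obtain ⟨s, hs, hqs⟩ := exists_imagUnits_eq_add_smul q
  rw [hqs] at hq hD ⊢
  rw [cauchyTransform_add_smul hU hF hs hq, cauchyIntegral_add_smul hU hF D hs hD]

/-- A formula with an explicit direction, fit for differentiating in `q`. At real `q` the direction
is `0`, harmless by `stemValue_zero`. -/
theorem cauchyTransform_eq_stemValue {U : Set ℂ} (hU : IsOpen U) {F : ℂ → BiQuat}
    (hF : DifferentiableOn ℂ F U) {q : Quaternion ℝ} (hq : q ∈ quatSet U) :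
    cauchyTransform U F q = stemValue F q.re ‖q.im‖ (‖q.im‖⁻¹ • q.im) := by
  obtain ⟨s, hs, hqs⟩ := exists_imagUnits_eq_add_smul q
  by_cases h : q.im = 0
  · have hq' := hq
    rw [hqs] at hq'
    have := cauchyTransform_add_smul hU hF hs hq'
    rw [← hqs] at this
    rw [this, h, norm_zero, stemValue_zero, stemValue_zero]
  · have hq' := hq
    rw [← add_smul_normalized_im q] at hq'
    have := cauchyTransform_add_smul hU hF (normalized_im_mem_imagUnits h) hq'
    rwa [add_smul_normalized_im q] at this

/-! ### Real differentiability. -/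

/-- The imaginary part of a quaternion as a continuous linear map. -/
noncomputable def quatImCLM : Quaternion ℝ →L[ℝ] Quaternion ℝ :=
  LinearMap.toContinuousLinearMap
    { toFun := fun q => q.im
      map_add' := fun a b => Quaternion.im_add a b
      map_smul' := fun r a => Quaternion.im_smul a r }

/-- The real part of a quaternion as a continuous linear map. -/
noncomputable def quatReCLM : Quaternion ℝ →L[ℝ] ℝ :=
  LinearMap.toContinuousLinearMap
    { toFun := fun q => q.re
      map_add' := fun a b => Quaternion.re_add a b
      map_smul' := fun r a => Quaternion.re_smul a r }

theorem differentiable_halfProj : Differentiable ℝ halfProj := by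
  have h : Differentiable ℝ fun s => ofQuat s := ofQuatCLM.differentiable
  unfold halfProj
  exact ((differentiable_const _).sub (h.const_smul Complex.I)).const_smul (1 / 2 : ℂ)

theorem differentiableAt_stemValue {F : ℂ → BiQuat} {q : Quaternion ℝ} (hq : q.im ≠ 0)
    (h₁ : DifferentiableAt ℂ F (q.re + ‖q.im‖ * Complex.I))
    (h₂ : DifferentiableAt ℂ F (q.re - ‖q.im‖ * Complex.I)) :
    DifferentiableAt ℝ
      (fun p : Quaternion ℝ => stemValue F p.re ‖p.im‖ (‖p.im‖⁻¹ • p.im)) q := by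
  have him : DifferentiableAt ℝ (fun p : Quaternion ℝ => p.im) q := quatImCLM.differentiableAt
  have hre : DifferentiableAt ℝ (fun p : Quaternion ℝ => (p.re : ℂ)) q :=
    Complex.ofRealCLM.differentiableAt.comp q quatReCLM.differentiableAt
  have hnorm : DifferentiableAt ℝ (fun p : Quaternion ℝ => ‖p.im‖) q := him.norm ℝ hq
  have hnormC : DifferentiableAt ℝ (fun p : Quaternion ℝ => (‖p.im‖ : ℂ) * Complex.I) q :=
    (Complex.ofRealCLM.differentiableAt.comp q hnorm).mul_const _
  have hu : DifferentiableAt ℝ (fun p : Quaternion ℝ => ‖p.im‖⁻¹ • p.im) q :=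
    (hnorm.inv (norm_ne_zero_iff.2 hq)).smul him
  have e₁ : DifferentiableAt ℝ (fun p : Quaternion ℝ => F (p.re + ‖p.im‖ * Complex.I)) q :=
    (h₁.restrictScalars ℝ).comp q (hre.add hnormC)
  have e₂ : DifferentiableAt ℝ (fun p : Quaternion ℝ => F (p.re - ‖p.im‖ * Complex.I)) q :=
    (h₂.restrictScalars ℝ).comp q (hre.sub hnormC)
  exact (e₁.mul ((differentiable_halfProj _).comp q hu)).add
    (e₂.mul ((differentiable_halfProj _).comp q hu.neg))

open Asymptotics Filter Topology in
-- Here `‖p.im‖` and the direction are not differentiable. Instead `F` is expanded to first order at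
-- `q₀.re`: the remainders are `o(q - q₀)` times bounded factors, and by `ofQuat_add_smul` the
-- linear terms recombine into `F' * (q - q₀)`.
theorem hasFDerivAt_stemValue_of_im_eq_zero {F : ℂ → BiQuat} {q₀ : Quaternion ℝ}
    (hq₀ : q₀.im = 0) {F' : BiQuat} (hF : HasDerivAt F F' q₀.re) :
    HasFDerivAt (fun p : Quaternion ℝ => stemValue F p.re ‖p.im‖ (‖p.im‖⁻¹ • p.im))
      ((ContinuousLinearMap.mul ℝ BiQuat F').comp ofQuatCLM) q₀ := by
  have hbdd : ∃ C, ∀ u : Quaternion ℝ, ‖u‖ ≤ 1 → ‖halfProj u‖ ≤ C := by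
    obtain ⟨C, hC⟩ := (isCompact_closedBall (0 : Quaternion ℝ) 1).exists_bound_of_continuousOn
      differentiable_halfProj.continuous.continuousOn
    exact ⟨C, fun u hu => hC u (mem_closedBall_zero_iff.2 hu)⟩
  obtain ⟨C, hC⟩ := hbdd
  have hu : ∀ q : Quaternion ℝ, ‖‖q.im‖⁻¹ • q.im‖ ≤ 1 := fun q => by
    rw [norm_smul, norm_inv, norm_norm]
    exact inv_mul_le_one
  have hIm := quatImCLM.isBigO_sub (l := 𝓝 q₀) q₀
  have hRe := quatReCLM.isBigO_sub (l := 𝓝 q₀) q₀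
  -- The values `ε = ±i` give the remainders of the two summands of `stemValue`.
  have key : ∀ (ε : ℂ) (v : Quaternion ℝ → Quaternion ℝ), (∀ q, ‖v q‖ ≤ 1) →
      (fun q : Quaternion ℝ => (F (q.re + ε * ‖q.im‖) - F q₀.re -
        ((q.re + ε * ‖q.im‖) - q₀.re : ℂ) • F') * halfProj (v q)) =o[𝓝 q₀] fun q => q - q₀ := by
    intro ε v hv
    have hO : (fun q : Quaternion ℝ => (q.re + ε * ‖q.im‖ : ℂ) - q₀.re) =O[𝓝 q₀]
        fun q => q - q₀ := by
      have h₁ : (fun q : Quaternion ℝ => (q.re - q₀.re : ℂ)) =O[𝓝 q₀] fun q => q - q₀ := by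
        refine (IsBigO.of_norm_left ?_)
        refine hRe.norm_left.congr_left fun q => ?_
        rw [← Complex.ofReal_sub, Complex.norm_real]
        rfl
      have h₂ : (fun q : Quaternion ℝ => (‖q.im‖ : ℂ)) =O[𝓝 q₀] fun q => q - q₀ := by
        refine (IsBigO.of_norm_left ?_)
        refine hIm.norm_left.congr_left fun q => ?_
        rw [Complex.norm_real, norm_norm]
        change ‖(q - q₀).im‖ = _
        rw [Quaternion.im_sub, hq₀, sub_zero]
      exact (h₁.add (h₂.const_mul_left ε)).congr_left fun q => by ring
    have hlim : Tendsto (fun q : Quaternion ℝ => (q.re + ε * ‖q.im‖ : ℂ)) (𝓝 q₀)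
        (𝓝 (q₀.re : ℂ)) := by
      have hc : Continuous fun q : Quaternion ℝ => (q.re + ε * ‖q.im‖ : ℂ) := by
        have h₁ := Quaternion.continuous_re
        have h₂ := Quaternion.continuous_im
        fun_prop
      refine hc.tendsto' _ _ ?_
      simp [hq₀]
    have ho := (hasDerivAt_iff_isLittleO.1 hF).comp_tendsto hlim
    have h1 : (fun q => halfProj (v q)) =O[𝓝 q₀] fun _ => (1 : ℝ) :=
      IsBigO.of_bound C (.of_forall fun q => by simpa using hC _ (hv q))
    have := (ho.trans_isBigO hO).norm_right.mul_isBigO h1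
    simp only [mul_one] at this
    exact this.of_norm_right
  have hs := (key Complex.I (fun q => ‖q.im‖⁻¹ • q.im) hu).add
    (key (-Complex.I) (fun q => -(‖q.im‖⁻¹ • q.im)) fun q => by rw [norm_neg]; exact hu q)
  refine HasFDerivAt.of_isLittleO (hs.congr_left fun q => ?_)
  have hq := ofQuat_add_smul q.re ‖q.im‖ (‖q.im‖⁻¹ • q.im)
  rw [add_smul_normalized_im] at hq
  have hq₀' : ofQuat q₀ = (q₀.re : ℂ) • 1 := by
    conv_lhs => rw [← Quaternion.re_add_im q₀, hq₀, add_zero, ofQuat_coe]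
  -- The value at `q₀` is split along the elements attached to the moving point `q`, to be compared
  -- term by term.
  have e₀ : stemValue F q₀.re ‖q₀.im‖ (‖q₀.im‖⁻¹ • q₀.im) =
      F q₀.re * (halfProj (‖q.im‖⁻¹ • q.im) + halfProj (-(‖q.im‖⁻¹ • q.im))) := by
    rw [hq₀, norm_zero, stemValue_zero, halfProj_add_halfProj_neg, mul_one]
  rw [e₀]
  simp only [ContinuousLinearMap.comp_apply, ContinuousLinearMap.mul_apply', ofQuatCLM_apply,
    map_sub]
  rw [hq, hq₀', ← halfProj_add_halfProj_neg (‖q.im‖⁻¹ • q.im), stemValue]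
  simp only [sub_mul, mul_add, smul_mul_assoc, mul_smul_comm, neg_mul,
    ← sub_eq_add_neg, mul_comm Complex.I]
  module

theorem cauchyTransform_differentiableOn {U : Set ℂ} (hU : IsOpen U) (hsymm : IsConjSymm U)
    {F : ℂ → BiQuat} (hF : DifferentiableOn ℂ F U) :
    DifferentiableOn ℝ (cauchyTransform U F) (quatSet U) := by
  intro q hq
  have hmem := (mem_quatSet_iff hsymm q).1 hq
  have hmem' := (hsymm.sub_mem_iff _ _).2 hmem
  have heq : cauchyTransform U F =ᶠ[nhds q]
      fun p : Quaternion ℝ => stemValue F p.re ‖p.im‖ (‖p.im‖⁻¹ • p.im) := by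
    filter_upwards [(isOpen_quatSet hU hsymm).mem_nhds hq] with p hp
    exact cauchyTransform_eq_stemValue hU hF hp
  refine (DifferentiableAt.congr_of_eventuallyEq ?_ heq).differentiableWithinAt
  by_cases h : q.im = 0
  · rw [h, norm_zero, Complex.ofReal_zero, zero_mul, add_zero] at hmem
    exact (hasFDerivAt_stemValue_of_im_eq_zero h
      (hF.differentiableAt (hU.mem_nhds hmem)).hasDerivAt).differentiableAt
  · exact differentiableAt_stemValue h (hF.differentiableAt (hU.mem_nhds hmem))
      (hF.differentiableAt (hU.mem_nhds hmem'))

/-! ### The slice Cauchy–Riemann equation. -/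

theorem hasDerivAt_stemValue_left {F : ℂ → BiQuat} {x y : ℝ} (s : Quaternion ℝ) {a b : BiQuat}
    (ha : HasDerivAt F a (x + y * Complex.I)) (hb : HasDerivAt F b (x - y * Complex.I)) :
    HasDerivAt (fun u : ℝ => stemValue F u y s) (a * halfProj s + b * halfProj (-s)) x := by
  have h : HasDerivAt (fun u : ℝ => (u : ℂ)) 1 x := Complex.ofRealCLM.hasDerivAt
  have h₁ := HasDerivAt.scomp x ha (h.add_const (y * Complex.I))
  have h₂ := HasDerivAt.scomp x hb (h.sub_const (y * Complex.I))
  rw [one_smul] at h₁ h₂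
  exact (h₁.mul_const _).add (h₂.mul_const _)

theorem hasDerivAt_stemValue_right {F : ℂ → BiQuat} {x y : ℝ} (s : Quaternion ℝ) {a b : BiQuat}
    (ha : HasDerivAt F a (x + y * Complex.I)) (hb : HasDerivAt F b (x - y * Complex.I)) :
    HasDerivAt (fun v : ℝ => stemValue F x v s)
      ((Complex.I • a) * halfProj s + (-Complex.I • b) * halfProj (-s)) y := by
  have h : HasDerivAt (fun v : ℝ => (v : ℂ) * Complex.I) Complex.I y := by
    simpa using (Complex.ofRealCLM.hasDerivAt (x := y)).mul_const Complex.I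
  have h₁ := HasDerivAt.scomp y ha (h.const_add (x : ℂ))
  have h₂ := HasDerivAt.scomp y hb (h.const_sub (x : ℂ))
  exact (h₁.mul_const _).add (h₂.mul_const _)

/-- For fixed `s` the closed formula holds for `y` of either sign, so real points need no separate
case. In each summand the `±i` from `∂/∂y` meets the same `±i` from right multiplication by `s`,
giving `-1` times the `∂/∂x` term. -/
theorem sliceDbar_cauchyTransform {U : Set ℂ} (hU : IsOpen U) (hsymm : IsConjSymm U)
    {F : ℂ → BiQuat} (hF : DifferentiableOn ℂ F U) {s : Quaternion ℝ} (hs : s ∈ imagUnits)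
    {x y : ℝ} (hq : (x : Quaternion ℝ) + y • s ∈ quatSet U) :
    sliceDbar s (cauchyTransform U F) x y = 0 := by
  have hmem := (add_smul_mem_quatSet hsymm hs x y).1 hq
  have ha := (hF.differentiableAt (hU.mem_nhds hmem)).hasDerivAt
  have hb := (hF.differentiableAt
    (hU.mem_nhds ((hsymm.sub_mem_iff _ _).2 hmem))).hasDerivAt
  have hnhds := (isOpen_quatSet hU hsymm).mem_nhds hq
  have hcx : ContinuousAt (fun u : ℝ => (u : Quaternion ℝ) + y • s) x :=
    (Quaternion.continuous_coe.add continuous_const).continuousAt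
  have hcy : ContinuousAt (fun v : ℝ => (x : Quaternion ℝ) + v • s) y := by fun_prop
  have hx : (fun u : ℝ => cauchyTransform U F ((u : Quaternion ℝ) + y • s)) =ᶠ[nhds x]
      fun u => stemValue F u y s := by
    filter_upwards [hcx.preimage_mem_nhds hnhds] with u hu
    exact cauchyTransform_add_smul hU hF hs hu
  have hy : (fun v : ℝ => cauchyTransform U F ((x : Quaternion ℝ) + v • s)) =ᶠ[nhds y]
      fun v => stemValue F x v s := by
    filter_upwards [hcy.preimage_mem_nhds hnhds] with v hv
    exact cauchyTransform_add_smul hU hF hs hv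
  rw [sliceDbar, hx.deriv_eq, hy.deriv_eq, (hasDerivAt_stemValue_left s ha hb).deriv,
    (hasDerivAt_stemValue_right s ha hb).deriv, add_mul, mul_assoc, mul_assoc,
    halfProj_mul_ofQuat hs, halfProj_neg_mul_ofQuat hs, mul_neg, smul_mul_smul_comm,
    smul_mul_smul_comm, neg_mul, Complex.I_mul_I]
  simp only [neg_neg, neg_smul, one_smul]
  rw [← neg_add, add_neg_cancel, smul_zero]

theorem mainTheorem6 (U : Set ℂ) (hU : IsOpen U) (hsymm : IsConjSymm U)
    (F : ℂ → BiQuat) (hF : AnalyticOnNhd ℂ F U) :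
    (∀ q ∈ quatSet U, (∃ D : CauchyDomain U, quatSpectrum q ⊆ D.carrier) ∧
      ∀ D : CauchyDomain U, quatSpectrum q ⊆ D.carrier →
        cauchyTransform U F q = cauchyIntegral D F q) ∧
    IsSliceRegularOn (cauchyTransform U F) (quatSet U) :=
  ⟨fun _ hq => ⟨exists_cauchyDomain_quatSpectrum_subset hU hq, fun D hD =>
      cauchyTransform_eq_cauchyIntegral hU hF.differentiableOn hq D hD⟩,
    isOpen_quatSet hU hsymm, cauchyTransform_differentiableOn hU hsymm hF.differentiableOn,
    fun _ hs _ _ hq => sliceDbar_cauchyTransform hU hsymm hF.differentiableOn hs hq⟩
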